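/- Let $k$ be a field. A curve over $k$ is a separated, smooth, geometrically integral $k$-scheme of finite type and of dimension $1$; a curve is hyperbolic if its base change to $\overline{k}$ has only finitely many $\overline{k}$-automorphisms. Let $X \xleftarrow{f} Z \xrightarrow{g} Y$ be an étale correspondence of projective hyperbolic curves over $k$ (so $f$ and $g$ are finite étale $k$-morphisms) without a core, i.e. $k(X)\cap k(Y)$, formed inside $k(Z)$, does not have transcendence degree $1$ over $k$. Let $\Omega$ be an algebraically closed field of transcendence degree $1$ over $k$ and fix a $k$-embedding $PQ\colon k(Z)\hookrightarrow\Omega$. The full generic graph has the $k$-embeddings $k(X)\to\Omega$ as blue vertices, the $k$-embeddings $k(Y)\to\Omega$ as red vertices and the $k$-embeddings $k(Z)\to\Omega$ as edges, an edge joining its restrictions to $k(X)$ and $k(Y)$; $\mathcal G_{gen}$ is the connected component of the edge $PQ$. The full physical graph has blue vertices $X(\overline k)$, red vertices $Y(\overline k)$ and edges $Z(\overline k)$, the edge $z$ joining $f(z)$ to $g(z)$; $\mathcal G_{phys,z}$ is the connected component of the edge $z$. (Multiple edges are allowed in both graphs.) Let $E_\infty\subset\Omega$ be the union of the tower of fields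 obtained from $PQ(k(Z))$ by taking iterated Galois closures in $\Omega$, alternately over $k(Y)$ and over $k(X)$, and let $W_\infty\to Z$ be the inverse limit of the corresponding tower of curves over $Z$, i.e. the normalization of $Z$ in $E_\infty$. Let $z\in Z(\overline k)$, let $\tilde z\in W_\infty(\overline k)$ be a point over $z$, and let $\pi\colon\mathcal O_{W_\infty,\tilde z}\to\overline k$ be the evaluation homomorphism at $\tilde z$. For $T\in\{X,Y,Z\}$, an $E_\infty$-point of $T$ specializes to $t\in T(\overline k)$ if it extends to a $k$-morphism $\operatorname{Spec}\mathcal O_{W_\infty,\tilde z}\to T$ whose composite with $\operatorname{Spec}\pi$ is $t$. Then there is exactly one map of graphs $$s_{\tilde z}\colon \mathcal G_{gen}\to\mathcal G_{phys,z}$$ such that every blue vertex, red vertex and edge of $\mathcal G_{gen}$ takes values in $E_\infty$ and, viewed as an $E_\infty$-point of $X$, $Y$, $Z$ respectively, specializes to its image under $s_{\tilde z}$ (the specialization map). Every such specialization map is surjective on vertices and on edges, and it is a covering of graphs: for every vertex $v$ of $\mathcal G_{gen}$ it maps the set of edges at $v$ bijectively onto the set of edges at $s_{\tilde z}(v)$.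 -/

import Mathlib

open CategoryTheory AlgebraicGeometry

universe u

namespace CurveCorr

noncomputable section

/-! ### Curves over a field -/

/-- Schemes over a field `k`. -/
abbrev SchOver (k : Type u) [Field k] : Type (u + 1) :=
  Over (Spec (CommRingCat.of k))

/-- A (smooth) curve over `k`: a separated, quasi-compact, geometrically integral scheme,
smooth of relative dimension `1` over `k`. -/
class IsCurve {k : Type u} [Field k] (X : SchOver k) : Prop where
  geometricallyIntegral : GeometricallyIntegral X.hom
  smooth : SmoothOfRelativeDimension 1 X.hom
  separated : IsSeparated X.hom
  quasiCompact : QuasiCompact X.hom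

instance isIntegral_left {k : Type u} [Field k] (X : SchOver k) [h : IsCurve X] :
    IsIntegral X.left := by
  have := h.geometricallyIntegral
  have : Subsingleton (Spec (CommRingCat.of k)) :=
    inferInstanceAs (Subsingleton (PrimeSpectrum k))
  exact GeometricallyIntegral.isIntegral_of_subsingleton X.hom

/-- `Spec A` as a scheme over `k`, for a `k`-algebra `A`. -/
def specOver (k : Type u) [Field k] (A : Type u) [CommRing A] [Algebra k A] : SchOver k :=
  Over.mk (Spec.map (CommRingCat.ofHom (algebraMap k A)))

/-- The set `X(A)` of `A`-valued points of `X` over `k`. -/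
abbrev Points {k : Type u} [Field k] (X : SchOver k) (A : Type u) [CommRing A] [Algebra k A] :
    Type u :=
  specOver k A ⟶ X

/-- A curve is hyperbolic if the group of `k̄`-automorphisms of its base change to an algebraic
closure `k̄` of `k` is finite. -/
def IsHyperbolic {k : Type u} [Field k] (X : SchOver k) : Prop :=
  Finite (Aut ((Over.pullback (Spec.map (CommRingCat.ofHom
    (algebraMap k (AlgebraicClosure k))))).obj X))

/-! ### Function fields -/

/-- The function field `k(X)` of a curve. -/
def FunField {k : Type u} [Field k] (X : SchOver k) [IsCurve X] : Type u :=
  X.left.functionField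

instance instFieldFunField {k : Type u} [Field k] (X : SchOver k) [IsCurve X] :
    Field (FunField X) :=
  inferInstanceAs (Field X.left.functionField)

/-- The inclusion of the generic point `Spec k(X) ⟶ X`. -/
def fromSpecFunField {k : Type u} [Field k] (X : SchOver k) [IsCurve X] :
    Spec (CommRingCat.of (FunField X)) ⟶ X.left :=
  X.left.fromSpecStalk (genericPoint X.left)

/-- The `k`-algebra structure of `k(X)` is the one given by `Spec k(X) ⟶ X ⟶ Spec k`. -/
instance instAlgebraFunField {k : Type u} [Field k] (X : SchOver k) [IsCurve X] :
    Algebra k (FunField X) :=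
  (Spec.preimage (fromSpecFunField X ≫ X.hom)).hom.toAlgebra

theorem specMap_algebraMap_funField {k : Type u} [Field k] (X : SchOver k) [IsCurve X] :
    Spec.map (CommRingCat.ofHom (algebraMap k (FunField X))) = fromSpecFunField X ≫ X.hom :=
  Spec.map_preimage _

theorem specMap_comp_fromSpecFunField {k : Type u} [Field k] {X : SchOver k} [IsCurve X]
    {F : Type u} [Field F] [Algebra k F] (φ : FunField X →ₐ[k] F) :
    (Spec.map (CommRingCat.ofHom φ.toRingHom) ≫ fromSpecFunField X) ≫ X.hom =
      Spec.map (CommRingCat.ofHom (algebraMap k F)) := by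
  rw [Category.assoc, ← specMap_algebraMap_funField, ← Spec.map_comp, ← CommRingCat.ofHom_comp]
  exact congrArg (fun ψ => Spec.map (CommRingCat.ofHom ψ)) φ.comp_algebraMap

theorem map_genericPoint {k : Type u} [Field k] {Z X : SchOver k} [IsCurve Z] [IsCurve X]
    (f : Z ⟶ X) [IsDominant f.left] : f.left (genericPoint Z.left) = genericPoint X.left := by
  apply ((genericPoint_spec X.left).eq _).symm
  have h := (genericPoint_spec Z.left).image f.left.continuous
  rw [Set.image_univ, f.left.denseRange.closure_range] at h
  exact h

/-- The map of local rings at the generic points underlying `f^* : k(X) → k(Z)`. -/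
def pullbackHom {k : Type u} [Field k] {Z X : SchOver k} [IsCurve Z] [IsCurve X]
    (f : Z ⟶ X) [IsDominant f.left] :
    CommRingCat.of (FunField X) ⟶ CommRingCat.of (FunField Z) :=
  X.left.presheaf.stalkSpecializes (specializes_of_eq (map_genericPoint f)) ≫
    f.left.stalkMap (genericPoint Z.left)

theorem specMap_pullbackHom {k : Type u} [Field k] {Z X : SchOver k} [IsCurve Z] [IsCurve X]
    (f : Z ⟶ X) [IsDominant f.left] :
    Spec.map (pullbackHom f) ≫ fromSpecFunField X = fromSpecFunField Z ≫ f.left := by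
  have h1 := Scheme.SpecMap_stalkMap_fromSpecStalk f.left (x := genericPoint Z.left)
  have h2 := Scheme.SpecMap_stalkSpecializes_fromSpecStalk
    (specializes_of_eq (map_genericPoint f))
  simp only [pullbackHom, fromSpecFunField]
  refine Eq.trans ?_ h1
  rw [← h2]
  exact (congrArg (· ≫ _) (Spec.map_comp _ _)).trans (Category.assoc _ _ _)

/-- The pullback `f^* : k(X) → k(Z)` of rational functions along a dominant morphism. -/
def pullbackAlgHom {k : Type u} [Field k] {Z X : SchOver k} [IsCurve Z] [IsCurve X]
    (f : Z ⟶ X) [IsDominant f.left] : FunField X →ₐ[k] FunField Z :=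
  { (pullbackHom f).hom with
    commutes' := by
      have h : CommRingCat.ofHom (algebraMap k (FunField X)) ≫ pullbackHom f =
          CommRingCat.ofHom (algebraMap k (FunField Z)) := by
        apply Spec.map_injective
        rw [Spec.map_comp, specMap_algebraMap_funField, specMap_algebraMap_funField,
          ← Category.assoc, specMap_pullbackHom, Category.assoc, Over.w]
      intro r
      exact congrArg (fun φ => φ.hom r) h }

/-- The point of `X` with values in a field extension `F` of `k` given by a `k`-embedding
`k(X) → F`, that is, `Spec F ⟶ Spec k(X) ⟶ X`. -/
def toPoint {k : Type u} [Field k] {X : SchOver k} [IsCurve X] {F : Type u} [Field F]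
    [Algebra k F] (φ : FunField X →ₐ[k] F) : Points X F :=
  Over.homMk (Spec.map (CommRingCat.ofHom φ.toRingHom) ≫ fromSpecFunField X)
    (specMap_comp_fromSpecFunField φ)

/-! ### Correspondences -/

/-- Generic separability of `f`: the extension `k(Z) / f^* k(X)` is separable. -/
def IsGenericallySeparable {k : Type u} [Field k] {Z X : SchOver k} [IsCurve Z] [IsCurve X]
    (f : Z ⟶ X) [IsDominant f.left] : Prop :=
  letI : Algebra (FunField X) (FunField Z) := (pullbackAlgHom f).toRingHom.toAlgebra
  Algebra.IsSeparable (FunField X) (FunField Z)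

/-- A correspondence `X ← Z → Y` of curves over `k`: the two morphisms are finite, non-constant
(that is, dominant) and generically separable. -/
structure Correspondence (k : Type u) [Field k] where
  X : SchOver k
  Y : SchOver k
  Z : SchOver k
  [curveX : IsCurve X]
  [curveY : IsCurve Y]
  [curveZ : IsCurve Z]
  f : Z ⟶ X
  g : Z ⟶ Y
  [finite_f : IsFinite f.left]
  [finite_g : IsFinite g.left]
  [dominant_f : IsDominant f.left]
  [dominant_g : IsDominant g.left]
  separable_f : IsGenericallySeparable f
  separable_g : IsGenericallySeparable g

attribute [instance] Correspondence.curveX Correspondence.curveY Correspondence.curveZ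
  Correspondence.finite_f Correspondence.finite_g Correspondence.dominant_f
  Correspondence.dominant_g

namespace Correspondence

variable {k : Type u} [Field k] (C : Correspondence k)

/-- Both maps are étale. -/
def IsEtale : Prop := Etale C.f.left ∧ Etale C.g.left

/-- The three curves are projective; for curves over a field this is the same as proper. -/
def IsProjective : Prop := IsProper C.X.hom ∧ IsProper C.Y.hom ∧ IsProper C.Z.hom

/-- The three curves are hyperbolic. -/
def Hyperbolic : Prop := IsHyperbolic C.X ∧ IsHyperbolic C.Y ∧ IsHyperbolic C.Z

/-- `k(X) ∩ k(Y)`, formed inside `k(Z)`, has transcendence degree `1` over `k`. -/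
def HasCore : Prop :=
  Algebra.trdeg k
    ((pullbackAlgHom C.f).fieldRange ⊓ (pullbackAlgHom C.g).fieldRange :
      IntermediateField k (FunField C.Z)) = 1

end Correspondence

/-! ### Two-coloured graphs -/

/-- A graph with blue and red vertices in which every edge joins a blue vertex to a red one
(several edges between the same two vertices are allowed). -/
structure BicoloredGraph where
  Blue : Type u
  Red : Type u
  Edge : Type u
  blue : Edge → Blue
  red : Edge → Red

namespace BicoloredGraph

variable (G H : BicoloredGraph.{u})

/-- Two vertices lie in the same connected component: the equivalence relation generated by
adjacency. -/
def SameComponent : G.Blue ⊕ G.Red → G.Blue ⊕ G.Red → Prop :=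
  Relation.EqvGen fun v w => ∃ e : G.Edge, v = Sum.inl (G.blue e) ∧ w = Sum.inr (G.red e)

/-- The connected component of `G` that contains the edge `e₀`. -/
def component (e₀ : G.Edge) : BicoloredGraph.{u} where
  Blue := {b : G.Blue // G.SameComponent (Sum.inl (G.blue e₀)) (Sum.inl b)}
  Red := {r : G.Red // G.SameComponent (Sum.inl (G.blue e₀)) (Sum.inr r)}
  Edge := {e : G.Edge // G.SameComponent (Sum.inl (G.blue e₀)) (Sum.inl (G.blue e))}
  blue e := ⟨G.blue e.1, e.2⟩
  red e := ⟨G.red e.1, e.2.trans _ _ _ (.rel _ _ ⟨e.1, rfl, rfl⟩)⟩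

/-- A map of two-coloured graphs. -/
structure Map where
  onBlue : G.Blue → H.Blue
  onRed : G.Red → H.Red
  onEdge : G.Edge → H.Edge
  blue_onEdge : ∀ e, H.blue (onEdge e) = onBlue (G.blue e)
  red_onEdge : ∀ e, H.red (onEdge e) = onRed (G.red e)

variable {G H}

/-- Surjectivity on vertices and on edges. -/
def Map.IsSurjective (s : Map G H) : Prop :=
  Function.Surjective s.onBlue ∧ Function.Surjective s.onRed ∧ Function.Surjective s.onEdge

/-- A covering of graphs: a surjective map that is bijective on the star of every vertex. -/
def Map.IsCovering (s : Map G H) : Prop :=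
  s.IsSurjective ∧
  (∀ v : G.Blue, Set.BijOn s.onEdge {e | G.blue e = v} {e | H.blue e = s.onBlue v}) ∧
  (∀ v : G.Red, Set.BijOn s.onEdge {e | G.red e = v} {e | H.red e = s.onRed v})

end BicoloredGraph

namespace Correspondence

variable {k : Type u} [Field k] (C : Correspondence k)

/-! ### The generic graph -/

section Generic

variable {Ω : Type u} [Field Ω] [Algebra k Ω]

/-- The full generic graph: blue vertices, red vertices and edges are the `k`-embeddings into `Ω`
of `k(X)`, `k(Y)` and `k(Z)`, and an edge joins its two restrictions. -/
def fullGenericGraph (Ω : Type u) [Field Ω] [Algebra k Ω] : BicoloredGraph.{u} where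
  Blue := FunField C.X →ₐ[k] Ω
  Red := FunField C.Y →ₐ[k] Ω
  Edge := FunField C.Z →ₐ[k] Ω
  blue e := e.comp (pullbackAlgHom C.f)
  red e := e.comp (pullbackAlgHom C.g)

/-- The generic graph: the connected component of the distinguished edge `PQ`. -/
def genericGraph (PQ : FunField C.Z →ₐ[k] Ω) : BicoloredGraph.{u} :=
  (C.fullGenericGraph Ω).component PQ

/-- The Galois (that is, normal) closure in `Ω` of a subfield `E` over a subfield `i(K)` of `E`:
the compositum of the images of all embeddings `E → Ω` that fix `i(K)`. -/
def galoisClosure {K : Type u} [Field K] [Algebra k K] (i : K →ₐ[k] Ω)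
    (E : IntermediateField k Ω) : IntermediateField k Ω :=
  ⨆ σ : {σ : E →ₐ[k] Ω // ∀ (a : K) (ha : i a ∈ E), σ ⟨i a, ha⟩ = i a}, σ.1.fieldRange

/-- The tower of iterated Galois closures in `Ω`, alternately over `k(Y)` and over `k(X)`,
starting with `k(Z)`. -/
def tower (PQ : FunField C.Z →ₐ[k] Ω) : ℕ → IntermediateField k Ω
  | 0 => PQ.fieldRange
  | n + 1 =>
    if Even n then galoisClosure (PQ.comp (pullbackAlgHom C.g)) (tower PQ n)
    else galoisClosure (PQ.comp (pullbackAlgHom C.f)) (tower PQ n)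

/-- The field `E_∞`, the union of the tower. -/
def EInf (PQ : FunField C.Z →ₐ[k] Ω) : IntermediateField k Ω :=
  ⨆ n, C.tower PQ n

/-- The embedding `PQ`, with values in `E_∞`. -/
def toEInf (PQ : FunField C.Z →ₐ[k] Ω) : FunField C.Z →ₐ[k] C.EInf PQ :=
  (IntermediateField.inclusion (le_iSup (C.tower PQ) 0)).comp PQ.rangeRestrict

/-- The morphism `Spec E_∞ ⟶ Z` given by `PQ`. -/
def specEInfToZ (PQ : FunField C.Z →ₐ[k] Ω) : Spec (CommRingCat.of (C.EInf PQ)) ⟶ C.Z.left :=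
  (toPoint (C.toEInf PQ)).left

instance (PQ : FunField C.Z →ₐ[k] Ω) : IsAffineHom (C.specEInfToZ PQ) := by
  have := C.curveZ.separated
  have : IsAffineHom (C.specEInfToZ PQ ≫ C.Z.hom) := by
    have h : C.specEInfToZ PQ ≫ C.Z.hom =
        Spec.map (CommRingCat.ofHom (algebraMap k (C.EInf PQ))) := Over.w (toPoint (C.toEInf PQ))
    rw [h]
    infer_instance
  exact IsAffineHom.of_comp _ C.Z.hom

/-- The scheme `W_∞`, the inverse limit of the tower of curves over `Z` with function fields
`C.tower PQ n`: it is the normalization of `Z` in `E_∞`. -/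
def WInf (PQ : FunField C.Z →ₐ[k] Ω) : SchOver k :=
  Over.mk ((C.specEInfToZ PQ).fromNormalization ≫ C.Z.hom)

/-- The projection `W_∞ ⟶ Z`. -/
def WInfToZ (PQ : FunField C.Z →ₐ[k] Ω) : C.WInf PQ ⟶ C.Z :=
  Over.homMk (C.specEInfToZ PQ).fromNormalization

/-- The inclusion `Spec E_∞ ⟶ W_∞` of the generic point. -/
def specEInfToWInf (PQ : FunField C.Z →ₐ[k] Ω) :
    Spec (CommRingCat.of (C.EInf PQ)) ⟶ (C.WInf PQ).left :=
  (C.specEInfToZ PQ).toNormalization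

end Generic

/-! ### The physical graph -/

/-- The full physical graph: blue vertices, red vertices and edges are the `k̄`-points of `X`, `Y`
and `Z`, and `z` joins `f ∘ z` to `g ∘ z`. -/
def fullPhysicalGraph (kbar : Type u) [Field kbar] [Algebra k kbar] : BicoloredGraph.{u} where
  Blue := Points C.X kbar
  Red := Points C.Y kbar
  Edge := Points C.Z kbar
  blue z := z ≫ C.f
  red z := z ≫ C.g

/-- The connected component of the full physical graph that contains `z`. -/
def physicalGraph {kbar : Type u} [Field kbar] [Algebra k kbar] (z : Points C.Z kbar) :
    BicoloredGraph.{u} :=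
  (C.fullPhysicalGraph kbar).component z

/-! ### Specialization -/

section Specialization

variable {Ω : Type u} [Field Ω] [Algebra k Ω] {PQ : FunField C.Z →ₐ[k] Ω}
  {kbar : Type u} [Field kbar] [Algebra k kbar]

/-- The image in `W_∞` of a geometric point of `W_∞`. -/
def center (w : Points (C.WInf PQ) kbar) : (C.WInf PQ).left :=
  w.left (IsLocalRing.closedPoint kbar)

/-- The local ring `𝒪_{W_∞, w}`. -/
def localRing (w : Points (C.WInf PQ) kbar) : CommRingCat.{u} :=
  (C.WInf PQ).left.presheaf.stalk (C.center w)

/-- The morphism `Spec 𝒪_{W_∞, w} ⟶ W_∞`. -/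
def fromSpecLocalRing (w : Points (C.WInf PQ) kbar) :
    Spec (C.localRing w) ⟶ (C.WInf PQ).left :=
  (C.WInf PQ).left.fromSpecStalk (C.center w)

/-- The homomorphism `π : 𝒪_{W_∞, w} → k̄` given by the geometric point `w`. -/
def evalAt (w : Points (C.WInf PQ) kbar) : C.localRing w ⟶ CommRingCat.of kbar :=
  Scheme.stalkClosedPointTo (R := CommRingCat.of kbar) w.left

/-- The `E_∞`-point `x` of the `k`-scheme `T` specializes at `w` to the `k̄`-point `t`: there is a
`k`-morphism `h : Spec 𝒪_{W_∞, w} ⟶ T` that restricts to `x` along the inclusion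
`η : Spec E_∞ ⟶ Spec 𝒪_{W_∞, w}` of the generic point and to `t` along `Spec π`. -/
def SpecializesTo (w : Points (C.WInf PQ) kbar) {T : SchOver k} (x : Points T (C.EInf PQ))
    (t : Points T kbar) : Prop :=
  ∃ (η : Spec (CommRingCat.of (C.EInf PQ)) ⟶ Spec (C.localRing w))
    (h : Spec (C.localRing w) ⟶ T.left),
    η ≫ C.fromSpecLocalRing w = C.specEInfToWInf PQ ∧
    h ≫ T.hom = C.fromSpecLocalRing w ≫ (C.WInf PQ).hom ∧
    η ≫ h = x.left ∧
    Spec.map (C.evalAt w) ≫ h = t.left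

/-- `s` is the specialization map attached to the geometric point `w` of `W_∞`: every edge `e` of
the generic graph has image in `E_∞`, and the `E_∞`-point of `Z` so obtained specializes at `w`
to `s(e)`; likewise for the blue and for the red vertices. -/
def IsSpecializationMap (w : Points (C.WInf PQ) kbar) {z : Points C.Z kbar}
    (s : BicoloredGraph.Map (C.genericGraph PQ) (C.physicalGraph z)) : Prop :=
  (∀ p : (C.genericGraph PQ).Blue, ∃ p₀ : FunField C.X →ₐ[k] C.EInf PQ,
    (C.EInf PQ).val.comp p₀ = p.1 ∧ C.SpecializesTo w (toPoint p₀) (s.onBlue p).1) ∧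
  (∀ q : (C.genericGraph PQ).Red, ∃ q₀ : FunField C.Y →ₐ[k] C.EInf PQ,
    (C.EInf PQ).val.comp q₀ = q.1 ∧ C.SpecializesTo w (toPoint q₀) (s.onRed q).1) ∧
  (∀ e : (C.genericGraph PQ).Edge, ∃ e₀ : FunField C.Z →ₐ[k] C.EInf PQ,
    (C.EInf PQ).val.comp e₀ = e.1 ∧ C.SpecializesTo w (toPoint e₀) (s.onEdge e).1)

end Specialization

end Correspondence

end

end CurveCorr

/-! Let `O` be the local ring of `W_∞` at the chosen geometric point. It is a local domain inside
`E_∞` and integrally closed in `E_∞`. Specializing an `E_∞`-point means extending it over `Spec O`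
and evaluating at the closed point; for a separated target the extension is unique, so
specialization is a single-valued relation.

Let `f` be a leg of the correspondence. Since `f` is integral, an `E_∞`-point of `Z` extends over
`Spec O` as soon as its image under `f` does (`exists_lift_of_isIntegralHom`), so specialization
passes from a vertex to the edges at it. Since `f` is unramified, two edges at one vertex with the
same specialization are equal (`lift_eq_of_formallyUnramified`): this is injectivity on stars. Since
`f` is flat, going-down lifts each physical edge at the image vertex to a generic `Ω`-point
(`exists_point_of_flat`): this is surjectivity on stars.

All this requires the generic edges to take values in `E_∞`. The alternating Galois closures make
`E_∞` normal over both `k(X)` and `k(Y)`, and hence each edge in the component of `PQ` is `PQ`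
followed by an automorphism of `E_∞` (`isConjugate_of_sameComponent`).

The rest is combinatorics (`existsUnique_map_and_isCovering`): from the pair `PQ`, `z`, the relation
spreads along paths of either graph, giving existence in one direction and surjectivity in the
other. -/

namespace CurveCorr

/-! ### Covering maps of connected components obtained from relations between graphs -/

namespace BicoloredGraph

variable {G H : BicoloredGraph.{u}}

theorem sameComponent_blue_iff_red (v : G.Blue ⊕ G.Red) (e : G.Edge) :
    G.SameComponent v (Sum.inl (G.blue e)) ↔ G.SameComponent v (Sum.inr (G.red e)) :=
  ⟨fun h => h.trans _ _ _ (.rel _ _ ⟨e, rfl, rfl⟩),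
    fun h => h.trans _ _ _ (.symm _ _ (.rel _ _ ⟨e, rfl, rfl⟩))⟩

/-- A property of vertices that passes along the edges of a component in both directions and
holds at one vertex holds on the whole component. -/
theorem SameComponent.induction {v₀ v : G.Blue ⊕ G.Red} (h : G.SameComponent v₀ v)
    {Q : G.Blue ⊕ G.Red → Prop} (h₀ : Q v₀)
    (hQ : ∀ e, G.SameComponent v₀ (Sum.inl (G.blue e)) →
      (Q (Sum.inl (G.blue e)) ↔ Q (Sum.inr (G.red e)))) : Q v := by
  -- Membership in the component is carried along with `Q`, because the generated equivalence
  -- relation also passes through pairs outside it. An equivalence rather than an implication is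
  -- needed for the symmetry case.
  have key : ∀ a b, G.SameComponent a b →
      ((G.SameComponent v₀ a ∧ Q a) ↔ (G.SameComponent v₀ b ∧ Q b)) := by
    intro a b hab
    induction hab with
    | rel a b hab =>
      obtain ⟨e, rfl, rfl⟩ := hab
      have := sameComponent_blue_iff_red v₀ e
      have := hQ e
      tauto
    | refl => rfl
    | symm _ _ _ ih => exact ih.symm
    | trans _ _ _ _ _ ih₁ ih₂ => exact ih₁.trans ih₂
  exact ((key v₀ v h).1 ⟨.refl _, h₀⟩).2

/-- A correspondence between two graphs that is single-valued and lifts stars uniquely, in both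
directions, along a component induces a unique map of components, and this map is a covering. -/
theorem existsUnique_map_and_isCovering {e₀ : G.Edge} {z₀ : H.Edge}
    {RB : G.Blue → H.Blue → Prop} {RR : G.Red → H.Red → Prop} {RE : G.Edge → H.Edge → Prop}
    (h₀ : RE e₀ z₀)
    (uB : ∀ {v x x'}, RB v x → RB v x' → x = x')
    (uR : ∀ {v x x'}, RR v x → RR v x' → x = x')
    (uE : ∀ {e t t'}, RE e t → RE e t' → t = t')
    (pB : ∀ {e t}, RE e t → RB (G.blue e) (H.blue t))
    (pR : ∀ {e t}, RE e t → RR (G.red e) (H.red t))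
    (lB : ∀ {e x}, G.SameComponent (Sum.inl (G.blue e₀)) (Sum.inl (G.blue e)) →
      RB (G.blue e) x → ∃ t, RE e t ∧ H.blue t = x)
    (lR : ∀ {e x}, G.SameComponent (Sum.inl (G.blue e₀)) (Sum.inl (G.blue e)) →
      RR (G.red e) x → ∃ t, RE e t ∧ H.red t = x)
    (iB : ∀ {e e' t}, RE e t → RE e' t → G.blue e = G.blue e' → e = e')
    (iR : ∀ {e e' t}, RE e t → RE e' t → G.red e = G.red e' → e = e')
    (sB : ∀ {v t}, G.SameComponent (Sum.inl (G.blue e₀)) (Sum.inl v) →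
      RB v (H.blue t) → ∃ e, G.blue e = v ∧ RE e t)
    (sR : ∀ {v t}, G.SameComponent (Sum.inl (G.blue e₀)) (Sum.inr v) →
      RR v (H.red t) → ∃ e, G.red e = v ∧ RE e t) :
    (∃! s : Map (G.component e₀) (H.component z₀),
      (∀ p, RB p.1 (s.onBlue p).1) ∧ (∀ q, RR q.1 (s.onRed q).1) ∧
        ∀ e, RE e.1 (s.onEdge e).1) ∧
    ∀ s : Map (G.component e₀) (H.component z₀),
      (∀ p, RB p.1 (s.onBlue p).1) ∧ (∀ q, RR q.1 (s.onRed q).1) ∧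
        (∀ e, RE e.1 (s.onEdge e).1) → s.IsSurjective ∧ s.IsCovering := by
  -- Path lifting from `G` to `H`: cross an edge by lifting it with `lB` or `lR`, then take its
  -- other end. Carrying membership in the component of `z₀` ensures that the map lands there.
  have exV : ∀ v, G.SameComponent (Sum.inl (G.blue e₀)) v →
      Sum.elim
        (fun b => ∃ x, H.SameComponent (Sum.inl (H.blue z₀)) (Sum.inl x) ∧ RB b x)
        (fun r => ∃ x, H.SameComponent (Sum.inl (H.blue z₀)) (Sum.inr x) ∧ RR r x) v := by
    intro v hv
    refine hv.induction (Q := Sum.elim _ _) ⟨_, .refl _, pB h₀⟩ fun e he => ⟨?_, ?_⟩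
    · rintro ⟨x, hx, hex⟩
      obtain ⟨t, ht, rfl⟩ := lB he hex
      exact ⟨_, (sameComponent_blue_iff_red _ _).1 hx, pR ht⟩
    · rintro ⟨x, hx, hex⟩
      obtain ⟨t, ht, rfl⟩ := lR he hex
      exact ⟨_, (sameComponent_blue_iff_red _ _).2 hx, pB ht⟩
  have exE : ∀ e : (G.component e₀).Edge, ∃ t : (H.component z₀).Edge, RE e.1 t.1 := by
    rintro ⟨e, he⟩
    obtain ⟨x, hx, hex⟩ := exV _ he
    obtain ⟨t, ht, rfl⟩ := lB he hex
    exact ⟨⟨t, hx⟩, ht⟩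
  have exB : ∀ p : (G.component e₀).Blue, ∃ x : (H.component z₀).Blue, RB p.1 x.1 := by
    rintro ⟨p, hp⟩
    obtain ⟨x, hx, hpx⟩ := exV _ hp
    exact ⟨⟨x, hx⟩, hpx⟩
  have exR : ∀ p : (G.component e₀).Red, ∃ x : (H.component z₀).Red, RR p.1 x.1 := by
    rintro ⟨p, hp⟩
    obtain ⟨x, hx, hpx⟩ := exV _ hp
    exact ⟨⟨x, hx⟩, hpx⟩
  choose sE hsE using exE
  choose sB' hsB using exB
  choose sR' hsR using exR
  refine ⟨⟨⟨sB', sR', sE, fun e => Subtype.ext (uB (pB (hsE e)) (hsB ((G.component e₀).blue e))),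
    fun e => Subtype.ext (uR (pR (hsE e)) (hsR ((G.component e₀).red e)))⟩, ⟨hsB, hsR, hsE⟩, ?_⟩, ?_⟩
  · rintro ⟨b, r, e, hb, hr⟩ ⟨h1, h2, h3⟩
    congr
    · exact funext fun p => Subtype.ext (uB (h1 p) (hsB p))
    · exact funext fun p => Subtype.ext (uR (h2 p) (hsR p))
    · exact funext fun p => Subtype.ext (uE (h3 p) (hsE p))
  · rintro s ⟨h1, h2, h3⟩
    -- The same argument with the graphs exchanged: paths in `H` are lifted to `G` by `sB` and `sR`.
    have suV : ∀ x, H.SameComponent (Sum.inl (H.blue z₀)) x →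
        Sum.elim
          (fun x => ∃ v, G.SameComponent (Sum.inl (G.blue e₀)) (Sum.inl v) ∧ RB v x)
          (fun x => ∃ v, G.SameComponent (Sum.inl (G.blue e₀)) (Sum.inr v) ∧ RR v x) x := by
      intro v hv
      refine hv.induction (Q := Sum.elim _ _) ⟨_, .refl _, pB h₀⟩ fun t ht => ⟨?_, ?_⟩
      · rintro ⟨v, hv, hvx⟩
        obtain ⟨e, rfl, he⟩ := sB hv hvx
        exact ⟨_, (sameComponent_blue_iff_red _ _).1 hv, pR he⟩
      · rintro ⟨v, hv, hvx⟩
        obtain ⟨e, rfl, he⟩ := sR hv hvx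
        exact ⟨_, (sameComponent_blue_iff_red _ _).2 hv, pB he⟩
    have surj : s.IsSurjective := by
      refine ⟨?_, ?_, ?_⟩
      · rintro ⟨x, hx⟩
        obtain ⟨v, hv, hvx⟩ := suV _ hx
        exact ⟨⟨v, hv⟩, Subtype.ext (uB (h1 _) hvx)⟩
      · rintro ⟨x, hx⟩
        obtain ⟨v, hv, hvx⟩ := suV _ hx
        exact ⟨⟨v, hv⟩, Subtype.ext (uR (h2 _) hvx)⟩
      · rintro ⟨t, ht⟩
        obtain ⟨v, hv, hvx⟩ := suV _ ht
        obtain ⟨e, rfl, he⟩ := sB hv hvx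
        exact ⟨⟨e, hv⟩, Subtype.ext (uE (h3 _) he)⟩
    refine ⟨surj, surj, fun v => ⟨?_, ?_, ?_⟩, fun v => ⟨?_, ?_, ?_⟩⟩
    · rintro e rfl
      exact s.blue_onEdge e
    · rintro e he e' he' hee
      refine Subtype.ext (iB (h3 e) (hee ▸ h3 e') ?_)
      exact congrArg Subtype.val (he.trans he'.symm)
    · rintro t ht
      have ht' : H.blue t.1 = (s.onBlue v).1 := congrArg Subtype.val ht
      obtain ⟨e, he, het⟩ := sB v.2 (ht' ▸ h1 v)
      exact ⟨⟨e, by rw [he]; exact v.2⟩, Subtype.ext he, Subtype.ext (uE (h3 _) het)⟩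
    · rintro e rfl
      exact s.red_onEdge e
    · rintro e he e' he' hee
      refine Subtype.ext (iR (h3 e) (hee ▸ h3 e') ?_)
      exact congrArg Subtype.val (he.trans he'.symm)
    · rintro t ht
      have ht' : H.red t.1 = (s.onRed v).1 := congrArg Subtype.val ht
      obtain ⟨e, he, het⟩ := sR v.2 (ht' ▸ h2 v)
      exact ⟨⟨e, (sameComponent_blue_iff_red _ _).2 (by rw [he]; exact v.2)⟩, Subtype.ext he,
        Subtype.ext (uE (h3 _) het)⟩

end BicoloredGraph

/-! ### Sections of finite étale morphisms over a local scheme -/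

section Sections

open Limits

variable {X Z : Scheme.{u}} (f : Z ⟶ X) {O : CommRingCat.{u}} (h : Spec O ⟶ X)

/-- The base change of an affine morphism to an affine scheme is affine. -/
theorem exists_isPullback_spec [IsAffineHom f] :
    ∃ (B : CommRingCat.{u}) (b : O ⟶ B) (q : Spec B ⟶ Z), IsPullback q (Spec.map b) f h := by
  have : IsAffine (pullback f h) := isAffine_of_isAffineHom (pullback.snd f h)
  let i := (pullback f h).isoSpec
  refine ⟨_, Spec.preimage (i.inv ≫ pullback.snd f h), i.inv ≫ pullback.fst f h, ?_⟩
  rw [Spec.map_preimage]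
  exact IsPullback.of_iso_pullback ⟨by simp [pullback.condition]⟩ i.symm (by simp) (by simp)

/-- Over a base that is integrally closed in `E`, an `E`-point of an integral scheme is
a section. -/
theorem exists_lift_of_isIntegralHom [IsIntegralHom f] {E : CommRingCat.{u}} (ι : O ⟶ E)
    (hinj : Function.Injective ι.hom)
    (hint : ∀ x : E, ι.hom.IsIntegralElem x → x ∈ Set.range ι.hom)
    (e : Spec E ⟶ Z) (he : e ≫ f = Spec.map ι ≫ h) :
    ∃ h' : Spec O ⟶ Z, h' ≫ f = h ∧ Spec.map ι ≫ h' = e := by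
  obtain ⟨B, b, q, hq⟩ := exists_isPullback_spec f h
  have hb : b.hom.IsIntegral := by
    rw [← IsIntegralHom.SpecMap_iff]
    exact MorphismProperty.of_isPullback hq inferInstance
  obtain ⟨χ, hχ⟩ := Spec.map_surjective (hq.lift e (Spec.map ι) he)
  have hbχ : b ≫ χ = ι := by
    apply Spec.map_injective
    rw [Spec.map_comp, hχ, hq.lift_snd]
  -- `B` is integral over `O`, so its image in `E` consists of integral elements and therefore lies
  -- in `O`. This turns the `E`-point of `B` into a section `σ : B → O`.
  have hmem : ∀ y : B, ∃ x : O, ι.hom x = χ.hom y := fun y => by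
    refine hint _ ?_
    obtain ⟨p, hp, hpy⟩ := hb y
    refine ⟨p, hp, ?_⟩
    rw [← hbχ, CommRingCat.hom_comp, ← Polynomial.hom_eval₂, hpy, map_zero]
  let σ : B →+* O := RingHom.comp
    ((RingEquiv.ofBijective ι.hom.rangeRestrict
      ⟨fun x y hxy => hinj (congrArg Subtype.val hxy), ι.hom.rangeRestrict_surjective⟩).symm :
        ι.hom.range →+* O)
    (χ.hom.codRestrict ι.hom.range hmem)
  have hσ : ∀ y, ι.hom (σ y) = χ.hom y := fun y =>
    congrArg Subtype.val ((RingEquiv.ofBijective ι.hom.rangeRestrict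
      ⟨fun x y hxy => hinj (congrArg Subtype.val hxy),
        ι.hom.rangeRestrict_surjective⟩).apply_symm_apply _)
  have h1 : CommRingCat.ofHom σ ≫ ι = χ := by
    ext y
    exact hσ y
  have h2 : b ≫ CommRingCat.ofHom σ = 𝟙 O := by
    ext x
    apply hinj
    refine (hσ _).trans ?_
    exact congrArg (fun φ => φ.hom x) hbχ
  refine ⟨Spec.map (CommRingCat.ofHom σ) ≫ q, ?_, ?_⟩
  · rw [Category.assoc, hq.w, ← Category.assoc, ← Spec.map_comp, h2, Spec.map_id,
      Category.id_comp]
  · rw [← Category.assoc, ← Spec.map_comp, h1, hχ, hq.lift_fst]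

/-- Two lifts along an unramified morphism of a morphism from the spectrum of a local ring are
equal if they agree on a point that lies over the closed point. -/
theorem lift_eq_of_formallyUnramified [FormallyUnramified f] [LocallyOfFiniteType f]
    [IsLocalRing O] {κ : Type u} [Field κ] (π : O ⟶ CommRingCat.of κ) [IsLocalHom π.hom]
    {h₁ h₂ : Spec O ⟶ Z} (hf : h₁ ≫ f = h₂ ≫ f) (hπ : Spec.map π ≫ h₁ = Spec.map π ≫ h₂) :
    h₁ = h₂ := by
  -- The locus where the two lifts agree is the pullback of the diagonal along `(h₁, h₂)`. It is
  -- open because `f` is unramified, and an open subset of `Spec O` containing the closed point is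
  -- everything.
  let m := pullback.lift h₁ h₂ hf
  let p := pullback.snd (pullback.diagonal f) m
  have hp : IsOpenImmersion p := inferInstance
  let l : Spec (CommRingCat.of κ) ⟶ pullback (pullback.diagonal f) m :=
    pullback.lift (Spec.map π ≫ h₁) (Spec.map π) (by
      apply pullback.hom_ext
      · simp [m, pullback.lift_fst]
      · simp [m, pullback.lift_snd, hπ])
  have hl : l ≫ p = Spec.map π := pullback.lift_snd _ _ _
  have htop : p.opensRange = ⊤ := by
    refine IsLocalRing.closed_point_mem_iff.mp ?_
    refine ⟨l (IsLocalRing.closedPoint κ), ?_⟩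
    refine (Scheme.Hom.comp_apply l p _).symm.trans ?_
    rw [hl]
    exact Spec_closedPoint (f := π)
  have : IsIso p := isIso_of_isOpenImmersion_of_opensRange_eq_top p htop
  have hm : m = (inv p ≫ pullback.fst (pullback.diagonal f) m) ≫ pullback.diagonal f := by
    rw [Category.assoc, pullback.condition, IsIso.inv_hom_id_assoc]
  have e1 : m ≫ pullback.fst f f = h₁ := pullback.lift_fst _ _ _
  have e2 : m ≫ pullback.snd f f = h₂ := pullback.lift_snd _ _ _
  rw [← e1, ← e2, hm, Category.assoc _ _ (pullback.fst f f), Category.assoc _ _ (pullback.snd f f),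
    pullback.diagonal_fst, pullback.diagonal_snd]

/-- A point of a flat integral algebra over a domain `O` is a specialization of a point over the
generic point of `O` with values in any given algebraically closed field containing `O`. -/
theorem exists_hom_ker_le {O B κ Ω : Type*} [CommRing O] [IsDomain O] [CommRing B] [Algebra O B]
    [Module.Flat O B] [Algebra.IsIntegral O B] [Field κ] [Field Ω] [IsAlgClosed Ω] [Algebra O Ω]
    [FaithfulSMul O Ω] (ψ : B →+* κ) :
    ∃ χ : B →ₐ[O] Ω, RingHom.ker χ ≤ RingHom.ker ψ := by
  have hprime : (RingHom.ker ψ).IsPrime := RingHom.ker_isPrime ψ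
  have : (RingHom.ker ψ).LiesOver ((RingHom.ker ψ).under O) := ⟨rfl⟩
  -- Going-down for the flat algebra `B`: a prime `P` inside `ker ψ` lying over the zero ideal.
  obtain ⟨P, hP, hPp, hPO⟩ := Ideal.exists_ideal_le_liesOver_of_le (p := (⊥ : Ideal O))
    (q := (RingHom.ker ψ).under O) (RingHom.ker ψ) bot_le
  have hinj : Function.Injective (algebraMap O (B ⧸ P)) := by
    rw [injective_iff_map_eq_zero]
    intro a ha
    have : a ∈ P.under O := by
      rw [Ideal.under_def, Ideal.mem_comap, ← Ideal.Quotient.eq_zero_iff_mem]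
      exact ha
    rwa [← hPO.over, Ideal.mem_bot] at this
  have : FaithfulSMul O (B ⧸ P) := (faithfulSMul_iff_algebraMap_injective _ _).2 hinj
  let χ : (B ⧸ P) →ₐ[O] Ω := IsAlgClosed.lift
  have hχ : Function.Injective χ := by
    rw [injective_iff_map_eq_zero]
    intro y hy
    by_contra hne
    -- A nonzero element integral over `O` divides a nonzero element of `O`, which cannot die in
    -- `Ω`.
    obtain ⟨a, ha, ha'⟩ := (Algebra.IsIntegral.isIntegral (R := O) y).isAlgebraic.exists_nonzero_dvd
      (mem_nonZeroDivisors_of_ne_zero hne)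
    obtain ⟨c, hc⟩ := ha'
    have : algebraMap O Ω a = 0 := by
      rw [← χ.commutes, hc, map_mul, hy, zero_mul]
    exact ha (FaithfulSMul.algebraMap_injective O Ω (this.trans (map_zero _).symm))
  refine ⟨χ.comp (Ideal.Quotient.mkₐ O P), fun y hy => hP ?_⟩
  rw [← Ideal.Quotient.eq_zero_iff_mem]
  exact hχ ((RingHom.mem_ker.1 hy).trans (map_zero χ).symm)

/-- Every point in the special fibre of a flat integral morphism over `O` is the specialization
of a point over the generic point of `O`. -/
theorem exists_point_of_flat [IsIntegralHom f] [Flat f] [IsDomain O] {κ Ω : Type u} [Field κ]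
    [Field Ω] [IsAlgClosed Ω] (ι : O ⟶ CommRingCat.of Ω) (hinj : Function.Injective ι.hom)
    (π : O ⟶ CommRingCat.of κ) (t : Spec (CommRingCat.of κ) ⟶ Z)
    (ht : t ≫ f = Spec.map π ≫ h) :
    ∃ x : Spec (CommRingCat.of Ω) ⟶ Z, x ≫ f = Spec.map ι ≫ h ∧
      ∀ h' : Spec O ⟶ Z, h' ≫ f = h → Spec.map ι ≫ h' = x → Spec.map π ≫ h' = t := by
  obtain ⟨B, b, q, hq⟩ := exists_isPullback_spec f h
  have hb : b.hom.IsIntegral := by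
    rw [← IsIntegralHom.SpecMap_iff]
    exact MorphismProperty.of_isPullback hq inferInstance
  have hb' : b.hom.Flat := by
    rw [← Flat.SpecMap_iff]
    exact MorphismProperty.of_isPullback hq inferInstance
  obtain ⟨ψ, hψ⟩ := Spec.map_surjective (hq.lift t (Spec.map π) ht)
  algebraize [b.hom]
  let : Algebra O Ω := ι.hom.toAlgebra
  have : FaithfulSMul O Ω := (faithfulSMul_iff_algebraMap_injective _ _).2 hinj
  have : Algebra.IsIntegral O B := ⟨hb⟩
  obtain ⟨χ, hχ⟩ := exists_hom_ker_le (O := O) (B := B) (Ω := Ω) ψ.hom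
  have hbχ : b ≫ CommRingCat.ofHom χ.toRingHom = ι := by
    ext x
    exact χ.commutes x
  have hbψ : b ≫ ψ = π := by
    apply Spec.map_injective
    rw [Spec.map_comp, hψ, hq.lift_snd]
  refine ⟨Spec.map (CommRingCat.ofHom χ.toRingHom) ≫ q, ?_, fun h' h1 h2 => ?_⟩
  · rw [Category.assoc, hq.w, ← Category.assoc, ← Spec.map_comp, hbχ]
  · obtain ⟨σ, hσ⟩ := Spec.map_surjective (hq.lift h' (𝟙 _) (by rw [h1, Category.id_comp]))
    have hσq : Spec.map σ ≫ q = h' := by rw [hσ, hq.lift_fst]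
    have hbσ : b ≫ σ = 𝟙 O := by
      apply Spec.map_injective
      rw [Spec.map_comp, hσ, hq.lift_snd, Spec.map_id]
    have hσι : σ ≫ ι = CommRingCat.ofHom χ.toRingHom := by
      apply Spec.map_injective
      apply hq.hom_ext
      · rw [← h2, Spec.map_comp, Category.assoc, hσq]
      · rw [← Spec.map_comp, ← Spec.map_comp, hbχ, ← Category.assoc, hbσ, Category.id_comp]
    have hσπ : σ ≫ π = ψ := by
      ext y
      -- The section identifies `y` with the scalar `σ y` up to `ker χ`. As `ker χ` is contained in
      -- `ker ψ`, the same congruence holds in the special fibre and forces `ψ` to be `σ` followed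
      -- by `π`.
      have hy : y - b.hom (σ.hom y) ∈ RingHom.ker χ := by
        rw [RingHom.mem_ker, map_sub, sub_eq_zero]
        have e1 : χ y = ι.hom (σ.hom y) := (congrArg (fun φ => φ.hom y) hσι).symm
        have e2 : χ (b.hom (σ.hom y)) = ι.hom (σ.hom y) :=
          congrArg (fun φ => φ.hom (σ.hom y)) hbχ
        rw [e1, e2]
      have hy' : ψ.hom y = ψ.hom (b.hom (σ.hom y)) := by
        have := RingHom.mem_ker.1 (hχ hy)
        rwa [map_sub, sub_eq_zero] at this
      rw [hy', ← hbψ]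
      rfl
    rw [← hσq, ← Category.assoc, ← Spec.map_comp, hσπ, hψ, hq.lift_fst]

end Sections

/-! ### Localizations of integral closures -/

/-- Clearing denominators: a suitable multiple of an element integral over the localization is
integral over `A`, hence comes from `A`, and the denominator is nonzero in `E`. -/
theorem injective_and_isIntegralElem_of_isLocalization {A O E : Type*} [CommRing A] [CommRing O]
    [Field E] [Algebra A O] (p : Ideal A) [p.IsPrime] [IsLocalization.AtPrime O p] (ι : O →+* E)
    (hinj : Function.Injective (ι.comp (algebraMap A O)))
    (hint : ∀ x : E, (ι.comp (algebraMap A O)).IsIntegralElem x →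
      x ∈ Set.range (ι.comp (algebraMap A O))) :
    Function.Injective ι ∧ ∀ x : E, ι.IsIntegralElem x → x ∈ Set.range ι := by
  refine ⟨(injective_iff_map_eq_zero _).2 fun y hy => ?_, fun x hx => ?_⟩
  · obtain ⟨a, s, rfl⟩ := IsLocalization.exists_mk'_eq p.primeCompl y
    have : ι (algebraMap A O a) = 0 := by
      rw [← IsLocalization.mk'_spec O a s, map_mul, hy, zero_mul]
    rw [hinj (this.trans (map_zero (ι.comp (algebraMap A O))).symm), IsLocalization.mk'_zero]
  · let : Algebra O E := ι.toAlgebra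
    let : Algebra A E := (ι.comp (algebraMap A O)).toAlgebra
    have : IsScalarTower A O E := .of_algebraMap_eq' rfl
    obtain ⟨m, hm⟩ := IsIntegral.exists_multiple_integral_of_isLocalization p.primeCompl x hx
    obtain ⟨a, ha⟩ := hint _ hm
    refine ⟨IsLocalization.mk' O a m, ?_⟩
    have hm0 : ι (algebraMap A O m) ≠ 0 := fun h0 => m.2 <| by
      rw [hinj (h0.trans (map_zero (ι.comp (algebraMap A O))).symm)]
      exact p.zero_mem
    apply mul_right_cancel₀ hm0
    rw [← map_mul, IsLocalization.mk'_spec]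
    refine ha.trans ?_
    rw [mul_comm]
    exact Algebra.smul_def m.1 x

/-! ### The local rings of a normalization in a field -/

/-- Transitivity of integrality, transported through isomorphisms, since sections of the
normalization are an integral closure only up to isomorphism. -/
theorem injective_and_isIntegralElem_integralClosure {A R B E : Type*} [CommRing A] [CommRing R]
    [Algebra A R] [CommRing B] [CommRing E] (i : B ≃+* integralClosure A R) (ρ : R ≃+* E)
    (φ : B →+* E) (hφ : ∀ b, φ b = ρ (i b)) :
    Function.Injective φ ∧ ∀ x : E, φ.IsIntegralElem x → x ∈ Set.range φ := by
  refine ⟨fun a b hab => i.injective (Subtype.val_injective (ρ.injective ?_)), ?_⟩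
  · rw [← hφ, ← hφ, hab]
  rintro x ⟨p, hp, hpx⟩
  have : IsIntegral (integralClosure A R) (ρ.symm x) := by
    refine ⟨p.map i.toRingHom, hp.map _, ρ.injective ?_⟩
    have h1 : (ρ : R →+* E).comp ((algebraMap (integralClosure A R) R).comp i.toRingHom) = φ :=
      RingHom.ext fun b => (hφ b).symm
    have h2 := Polynomial.hom_eval₂ p ((algebraMap (integralClosure A R) R).comp i.toRingHom)
      (ρ : R →+* E) (ρ.symm x)
    rw [h1] at h2
    rw [Polynomial.eval₂_map, map_zero]
    refine h2.trans ?_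
    rw [← hpx]
    exact congrArg (fun y => Polynomial.eval₂ φ y p) (ρ.apply_symm_apply x)
  have hx : IsIntegral A (ρ.symm x) := isIntegral_trans _ this
  refine ⟨i.symm ⟨_, hx⟩, ?_⟩
  rw [hφ, i.apply_symm_apply, ρ.apply_symm_apply]

/-- Over an affine open of `Z` the normalization is the spectrum of an integral closure in `E`, and
its stalks are localizations of that ring. So each stalk embeds in `E` and is integrally closed
there. -/
theorem exists_stalk_normalization_hom {Z : Scheme.{u}} {E : Type u} [Field E]
    (s : Spec (CommRingCat.of E) ⟶ Z) [QuasiCompact s] [QuasiSeparated s] (c : s.normalization) :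
    ∃ ι : s.normalization.presheaf.stalk c ⟶ CommRingCat.of E,
      Spec.map ι ≫ s.normalization.fromSpecStalk c = s.toNormalization ∧
      Function.Injective ι.hom ∧ ∀ x : E, ι.hom.IsIntegralElem x → x ∈ Set.range ι.hom := by
  have hξ : s.toNormalization (IsLocalRing.closedPoint E) ⤳ c := by
    rw [specializes_iff_mem_closure]
    have hd := s.toNormalization.denseRange c
    refine closure_mono ?_ hd
    rintro _ ⟨y, rfl⟩
    have : y = IsLocalRing.closedPoint E := Subsingleton.elim (α := PrimeSpectrum E) _ _
    rw [this]
    rfl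
  obtain ⟨_, ⟨U, hU, rfl⟩, hcU, -⟩ := Z.isBasis_affineOpens.exists_subset_of_mem_open
    (Set.mem_univ (s.fromNormalization c)) isOpen_univ
  replace hU : IsAffineOpen U := hU
  let V := s.fromNormalization ⁻¹ᵁ U
  have hV : IsAffineOpen V := hU.preimage _
  have hcV : c ∈ V := hcU
  have hξV : s.toNormalization (IsLocalRing.closedPoint E) ∈ V := hξ.mem_open V.2 hcV
  let ι := s.normalization.presheaf.stalkSpecializes hξ ≫
    Scheme.stalkClosedPointTo s.toNormalization
  refine ⟨ι, ?_, ?_⟩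
  · rw [Spec.map_comp, Category.assoc, Scheme.SpecMap_stalkSpecializes_fromSpecStalk]
    exact Scheme.Spec_stalkClosedPointTo_fromSpecStalk _
  let := (s.app U).hom.toAlgebra
  have htop : s ⁻¹ᵁ U = ⊤ := by
    have := Scheme.preimage_eq_top_of_closedPoint_mem s.toNormalization hξV
    rw [← Scheme.Hom.comp_preimage, s.toNormalization_fromNormalization] at this
    exact this
  let ρ : Γ(Spec (CommRingCat.of E), s ⁻¹ᵁ U) ≅ CommRingCat.of E :=
    (Spec (CommRingCat.of E)).presheaf.mapIso (eqToIso htop.symm).op ≪≫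
      Scheme.ΓSpecIso (CommRingCat.of E)
  have hj : s.normalization.presheaf.germ V c hcV ≫ ι =
      ((s.normalizationObjIso hU).hom ≫
        CommRingCat.ofHom (integralClosure Γ(Z, U) Γ(Spec (CommRingCat.of E), s ⁻¹ᵁ U)).val.toRingHom) ≫ ρ.hom := by
    have h1 := s.normalizationObjIso_hom_val hU
    rw [h1]
    rw [TopCat.Presheaf.germ_stalkSpecializes_assoc, Scheme.germ_stalkClosedPointTo _ _ hξV]
    simp only [Scheme.Hom.app_eq_appLE, ρ, Iso.trans_hom, Functor.mapIso_hom, Iso.op_hom,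
      Scheme.Hom.appLE_map_assoc]
    rfl
  let := TopCat.Presheaf.algebra_section_stalk s.normalization.presheaf (⟨c, hcV⟩ : V)
  have := hV.isLocalization_stalk ⟨c, hcV⟩
  have halg : ι.hom.comp (algebraMap Γ(s.normalization, V)
      (s.normalization.presheaf.stalk ((⟨c, hcV⟩ : V) : s.normalization))) =
      (s.normalization.presheaf.germ V c hcV ≫ ι).hom := rfl
  obtain ⟨h1, h2⟩ := injective_and_isIntegralElem_integralClosure
    (s.normalizationObjIso hU).commRingCatIsoToRingEquiv ρ.commRingCatIsoToRingEquiv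
    (ι.hom.comp (algebraMap Γ(s.normalization, V)
      (s.normalization.presheaf.stalk ((⟨c, hcV⟩ : V) : s.normalization))))
    (fun b => by rw [halg, hj]; rfl)
  exact injective_and_isIntegralElem_of_isLocalization (hV.primeIdealOf ⟨c, hcV⟩).asIdeal ι.hom
    h1 h2

/-! ### Embeddings of fields -/

section Fields

variable {k Ω : Type*} [Field k] [Field Ω] [Algebra k Ω]

/-- An embedding of a field into an algebraically closed field extends along an algebraic
extension. -/
theorem exists_algHom_comp_eq [IsAlgClosed Ω] {L F : Type*} [Field L] [Algebra k L] [Field F]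
    [Algebra k F] (p : L →ₐ[k] F) (hp : p.toRingHom.IsIntegral) (e : L →ₐ[k] Ω) :
    ∃ σ : F →ₐ[k] Ω, σ.comp p = e := by
  let := p.toRingHom.toAlgebra
  have : IsScalarTower k L F := .of_algebraMap_eq' p.comp_algebraMap.symm
  have : Algebra.IsIntegral L F := ⟨hp⟩
  obtain ⟨σ, hσ⟩ := IsAlgClosed.surjective_domRestrict_of_isAlgebraic (E := F) e
  exact ⟨σ, hσ⟩

/-- If `F` is normal over `i(K)` in the sense that every embedding over `i(K)` preserves `F`, then
every embedding that agrees on `i(K)` with an automorphism of `F` restricts to an automorphism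
of `F`. -/
theorem exists_algEquiv_of_forall_mem [IsAlgClosed Ω] {F : IntermediateField k Ω} {K : Type*}
    [Field K] [Algebra k K] (i : K →ₐ[k] F) (hi : i.toRingHom.IsIntegral)
    (hF : ∀ σ : F →ₐ[k] Ω, (∀ a, σ (i a) = i a) → ∀ y, σ y ∈ F)
    (τ : F ≃ₐ[k] F) (σ : F →ₐ[k] Ω) (hσ : ∀ a, σ (i a) = τ (i a)) :
    ∃ τ' : F ≃ₐ[k] F, ∀ y, (τ' y : Ω) = σ y := by
  -- `σ` is compared with `τ` by extending `τ⁻¹` to a field containing both `F` and the image of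
  -- `σ`. `Ω` need not be algebraic over `F`, so the extension is made on the algebraic closure of
  -- `F` in `Ω`.
  let A := (algebraicClosure F Ω).restrictScalars k
  have hA : ∀ y, σ y ∈ A := by
    intro y
    change IsIntegral F (σ y)
    obtain ⟨q, hq, hqy⟩ := hi y
    refine ⟨q.map (τ.toAlgHom.comp i).toRingHom, hq.map _, ?_⟩
    have h1 : (algebraMap F Ω).comp (τ.toAlgHom.comp i).toRingHom =
        σ.toRingHom.comp i.toRingHom := RingHom.ext fun a => (hσ a).symm
    rw [Polynomial.eval₂_map, h1]
    have := Polynomial.hom_eval₂ q i.toRingHom σ.toRingHom y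
    rw [hqy, map_zero] at this
    exact this.symm
  have hint : (algebraMap F (algebraicClosure F Ω)).IsIntegral :=
    Algebra.IsIntegral.isIntegral (R := F)
  obtain ⟨ρ, hρ⟩ := exists_algHom_comp_eq (k := k) (Ω := Ω)
    (IsScalarTower.toAlgHom k F (algebraicClosure F Ω)) hint (F.val.comp τ.symm.toAlgHom)
  have hρ' : ∀ y : F, ρ (algebraMap F (algebraicClosure F Ω) y) = τ.symm y :=
    fun y => DFunLike.congr_fun hρ y
  let σA : F →ₐ[k] algebraicClosure F Ω :=
    { toFun := fun y => ⟨σ y, hA y⟩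
      map_one' := Subtype.ext (map_one σ)
      map_zero' := Subtype.ext (map_zero σ)
      map_add' := fun a b => Subtype.ext (map_add σ a b)
      map_mul' := fun a b => Subtype.ext (map_mul σ a b)
      commutes' := fun r => Subtype.ext (σ.commutes r) }
  -- `ρ ∘ σ` fixes `i(K)`, so normality puts its values in `F`. Injectivity of `ρ` then identifies
  -- `σ y` with an element of `τ(F)`.
  have hfix : ∀ a, (ρ.comp σA) (i a) = i a := by
    intro a
    have : σA (i a) = algebraMap F (algebraicClosure F Ω) (τ (i a)) := Subtype.ext (hσ a)
    rw [AlgHom.comp_apply, this, hρ', AlgEquiv.symm_apply_apply]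
  have hmem : ∀ y, σ y ∈ F := by
    intro y
    have hy := hF _ hfix y
    have h1 : ρ (σA y) = ρ (algebraMap F (algebraicClosure F Ω) (τ ⟨_, hy⟩)) := by
      rw [hρ', AlgEquiv.symm_apply_apply]
      rfl
    have h2 : σ y = τ ⟨_, hy⟩ := congrArg Subtype.val (ρ.injective h1)
    rw [h2]
    exact Subtype.property _
  let σF : F →ₐ[k] F := σ.codRestrict F.toSubalgebra hmem
  let := i.toRingHom.toAlgebra
  have : Algebra.IsIntegral K F := ⟨hi⟩
  let σK : F →ₐ[K] F :=
    { τ.symm.toAlgHom.comp σF with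
      commutes' := fun a => by
        have : σF (i a) = τ (i a) := Subtype.ext (hσ a)
        change τ.symm (σF (i a)) = i a
        rw [this, AlgEquiv.symm_apply_apply] }
  -- An endomorphism of an algebraic extension is bijective; `τ⁻¹σ` is one because it fixes `K`.
  have hbij : Function.Bijective (τ.symm.toAlgHom.comp σF) :=
    Algebra.IsAlgebraic.algHom_bijective σK
  refine ⟨(AlgEquiv.ofBijective _ hbij).trans τ, fun y => ?_⟩
  change ((τ (τ.symm (σF y)) : F) : Ω) = σ y
  rw [AlgEquiv.apply_symm_apply]
  rfl

end Fields

/-! ### The tower of Galois closures and the normality of `E_∞` -/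

namespace Correspondence

variable {k : Type u} [Field k] (C : Correspondence k) {Ω : Type u} [Field Ω] [Algebra k Ω]

theorem le_galoisClosure {K : Type u} [Field K] [Algebra k K] (i : K →ₐ[k] Ω)
    (E : IntermediateField k Ω) : E ≤ galoisClosure i E := by
  refine le_trans ?_ (le_iSup (fun σ : {σ : E →ₐ[k] Ω // ∀ (a : K) (ha : i a ∈ E),
    σ ⟨i a, ha⟩ = i a} => σ.1.fieldRange) ⟨E.val, fun _ _ => rfl⟩)
  exact E.fieldRange_val.ge

theorem mem_galoisClosure {K : Type u} [Field K] [Algebra k K] (i : K →ₐ[k] Ω)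
    {E : IntermediateField k Ω} (σ : E →ₐ[k] Ω) (hσ : ∀ (a : K) (ha : i a ∈ E),
      σ ⟨i a, ha⟩ = i a) (y : E) : σ y ∈ galoisClosure i E :=
  le_iSup (fun σ : {σ : E →ₐ[k] Ω // ∀ (a : K) (ha : i a ∈ E),
    σ ⟨i a, ha⟩ = i a} => σ.1.fieldRange) ⟨σ, hσ⟩ ⟨y, rfl⟩

/-- The Galois closure of an algebraic extension is algebraic. -/
theorem isIntegralElem_of_mem_galoisClosure {K L : Type u} [Field K] [Algebra k K] [Field L]
    [Algebra k L] (j : K →ₐ[k] L) (hj : j.toRingHom.IsIntegral) (p : L →ₐ[k] Ω)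
    {E : IntermediateField k Ω} (hpE : p.fieldRange ≤ E)
    (hE : ∀ x ∈ E, p.toRingHom.IsIntegralElem x) :
    ∀ x ∈ galoisClosure (p.comp j) E, p.toRingHom.IsIntegralElem x := by
  let := p.toRingHom.toAlgebra
  let := j.toRingHom.toAlgebra
  let := (p.comp j).toRingHom.toAlgebra
  have : IsScalarTower k L Ω := .of_algebraMap_eq' p.comp_algebraMap.symm
  have : IsScalarTower K L Ω := .of_algebraMap_eq' rfl
  have : Algebra.IsIntegral K L := ⟨hj⟩
  suffices galoisClosure (p.comp j) E ≤ (algebraicClosure L Ω).restrictScalars k from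
    fun x hx => this hx
  refine iSup_le ?_
  rintro ⟨σ, hσ⟩ _ ⟨y, rfl⟩
  change IsIntegral L (σ y)
  -- The equation must have coefficients in `K`, as `σ` fixes the image of `K` but not that of `L`.
  have hy : IsIntegral K (y : Ω) := isIntegral_trans (A := L) _ (hE y y.2)
  obtain ⟨q, hq, hqy⟩ := hy
  have hmem : ∀ a, p.comp j a ∈ E := fun a => hpE ⟨j a, rfl⟩
  let iE : K →+* E := (p.comp j).toRingHom.codRestrict E hmem
  have h0 : q.eval₂ iE y = 0 := by
    apply Subtype.val_injective
    have := Polynomial.hom_eval₂ q iE E.val.toRingHom y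
    exact this.trans hqy
  have h1 : IsIntegral K (σ y) := by
    refine ⟨q, hq, ?_⟩
    have := Polynomial.hom_eval₂ q iE σ.toRingHom y
    rw [h0, map_zero] at this
    have h2 : σ.toRingHom.comp iE = algebraMap K Ω := RingHom.ext fun a => hσ a (hmem a)
    rw [h2] at this
    exact this.symm
  exact h1.tower_top

variable (PQ : FunField C.Z →ₐ[k] Ω)

theorem tower_monotone : Monotone (C.tower PQ) := by
  refine monotone_nat_of_le_succ fun n => ?_
  rw [tower]
  split_ifs <;> exact le_galoisClosure _ _

theorem isIntegral_pullbackAlgHom_f : (pullbackAlgHom C.f).toRingHom.IsIntegral := by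
  let := (pullbackAlgHom C.f).toRingHom.toAlgebra
  have : Algebra.IsSeparable (FunField C.X) (FunField C.Z) := C.separable_f
  exact Algebra.IsIntegral.isIntegral (R := FunField C.X)

theorem isIntegral_pullbackAlgHom_g : (pullbackAlgHom C.g).toRingHom.IsIntegral := by
  let := (pullbackAlgHom C.g).toRingHom.toAlgebra
  have : Algebra.IsSeparable (FunField C.Y) (FunField C.Z) := C.separable_g
  exact Algebra.IsIntegral.isIntegral (R := FunField C.Y)

theorem isIntegralElem_of_mem_tower (n : ℕ) :
    ∀ x ∈ C.tower PQ n, PQ.toRingHom.IsIntegralElem x := by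
  induction n with
  | zero =>
    rintro _ ⟨y, rfl⟩
    exact PQ.toRingHom.isIntegralElem_map
  | succ n ih =>
    have hPQ : PQ.fieldRange ≤ C.tower PQ n := C.tower_monotone PQ (Nat.zero_le n)
    rw [tower]
    split_ifs
    · exact isIntegralElem_of_mem_galoisClosure _ C.isIntegral_pullbackAlgHom_g PQ hPQ ih
    · exact isIntegralElem_of_mem_galoisClosure _ C.isIntegral_pullbackAlgHom_f PQ hPQ ih

theorem mem_EInf_iff (x : Ω) : x ∈ C.EInf PQ ↔ ∃ n, x ∈ C.tower PQ n := by
  rw [EInf, ← SetLike.mem_coe,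
    IntermediateField.coe_iSup_of_directed (C.tower_monotone PQ).directed_le, Set.mem_iUnion]
  rfl

theorem isIntegral_toEInf : (C.toEInf PQ).toRingHom.IsIntegral := by
  rintro ⟨x, hx⟩
  obtain ⟨n, hn⟩ := (C.mem_EInf_iff PQ x).1 hx
  obtain ⟨q, hq, hqx⟩ := C.isIntegralElem_of_mem_tower PQ n x hn
  refine ⟨q, hq, Subtype.val_injective ?_⟩
  exact (Polynomial.hom_eval₂ q (C.toEInf PQ).toRingHom (C.EInf PQ).val.toRingHom ⟨x, hx⟩).trans
    hqx

/-- Normality of `E_∞` over `j(K)`: each element lies in a stage whose closure over `j(K)` is again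
in the tower. It is enough that such stages be cofinal, which alternation provides for both legs. -/
theorem apply_mem_EInf_of_galoisClosure_le {K : Type u} [Field K] [Algebra k K]
    (j : K →ₐ[k] FunField C.Z)
    (hj : ∀ n, ∃ m ≥ n, galoisClosure (PQ.comp j) (C.tower PQ m) ≤ C.tower PQ (m + 1))
    (σ : C.EInf PQ →ₐ[k] Ω) (hσ : ∀ a, σ (C.toEInf PQ (j a)) = C.toEInf PQ (j a))
    (y : C.EInf PQ) : σ y ∈ C.EInf PQ := by
  obtain ⟨n, hn⟩ := (C.mem_EInf_iff PQ y).1 y.2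
  obtain ⟨m, hmn, hm⟩ := hj n
  refine (C.mem_EInf_iff PQ _).2 ⟨m + 1, hm ?_⟩
  exact mem_galoisClosure (PQ.comp j)
    (σ.comp (IntermediateField.inclusion (le_iSup (C.tower PQ) m)))
    (fun a _ => hσ a) ⟨y, C.tower_monotone PQ hmn hn⟩

theorem galoisClosure_f_le (n : ℕ) : ∃ m ≥ n,
    galoisClosure (PQ.comp (pullbackAlgHom C.f)) (C.tower PQ m) ≤ C.tower PQ (m + 1) := by
  have h : C.tower PQ (2 * n + 1 + 1) =
      galoisClosure (PQ.comp (pullbackAlgHom C.f)) (C.tower PQ (2 * n + 1)) := if_neg (by simp)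
  exact ⟨2 * n + 1, by omega, h.ge⟩

theorem galoisClosure_g_le (n : ℕ) : ∃ m ≥ n,
    galoisClosure (PQ.comp (pullbackAlgHom C.g)) (C.tower PQ m) ≤ C.tower PQ (m + 1) := by
  have h : C.tower PQ (2 * n + 1) =
      galoisClosure (PQ.comp (pullbackAlgHom C.g)) (C.tower PQ (2 * n)) := if_pos (by simp)
  exact ⟨2 * n, by omega, h.ge⟩

/-- The embeddings of `k(Z)` that are conjugate to `PQ` under an automorphism of `E_∞`. -/
def IsConjugate (e : FunField C.Z →ₐ[k] Ω) : Prop :=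
  ∃ τ : C.EInf PQ ≃ₐ[k] C.EInf PQ, ∀ a, (τ (C.toEInf PQ a) : Ω) = e a

variable {PQ}

theorem IsConjugate.exists_comp_eq {e : FunField C.Z →ₐ[k] Ω} (he : C.IsConjugate PQ e) :
    ∃ e₀ : FunField C.Z →ₐ[k] C.EInf PQ, (C.EInf PQ).val.comp e₀ = e := by
  obtain ⟨τ, hτ⟩ := he
  exact ⟨τ.toAlgHom.comp (C.toEInf PQ), AlgHom.ext hτ⟩

/-- Extend `e'` to `E_∞`; the extension agrees with `τ` on `j(K)`, so normality makes it an
automorphism of `E_∞`. -/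
theorem IsConjugate.of_comp_eq [IsAlgClosed Ω] {K : Type u} [Field K] [Algebra k K]
    {j : K →ₐ[k] FunField C.Z} (hint : j.toRingHom.IsIntegral)
    (hj : ∀ n, ∃ m ≥ n, galoisClosure (PQ.comp j) (C.tower PQ m) ≤ C.tower PQ (m + 1))
    {e e' : FunField C.Z →ₐ[k] Ω} (he : C.IsConjugate PQ e) (hee : e'.comp j = e.comp j) :
    C.IsConjugate PQ e' := by
  obtain ⟨τ, hτ⟩ := he
  obtain ⟨σ, hσ⟩ := exists_algHom_comp_eq (C.toEInf PQ) (C.isIntegral_toEInf PQ) e'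
  obtain ⟨τ', hτ'⟩ := exists_algEquiv_of_forall_mem ((C.toEInf PQ).comp j)
    (RingHom.IsIntegral.trans _ _ hint (C.isIntegral_toEInf PQ))
    (C.apply_mem_EInf_of_galoisClosure_le PQ j hj) τ σ
    (fun a => ((DFunLike.congr_fun hσ (j a)).trans (DFunLike.congr_fun hee a)).trans
      (hτ (j a)).symm)
  exact ⟨τ', fun a => (hτ' _).trans (DFunLike.congr_fun hσ a)⟩

end Correspondence

/-! ### Points of curves over the generic point -/

section Points

variable {k : Type u} [Field k]

theorem toPoint_injective {X : SchOver k} [IsCurve X] {F : Type u} [Field F] [Algebra k F] :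
    Function.Injective (toPoint : (FunField X →ₐ[k] F) → Points X F) := by
  intro φ φ' h
  have h1 : Spec.map (CommRingCat.ofHom φ.toRingHom) ≫ fromSpecFunField X =
      Spec.map (CommRingCat.ofHom φ'.toRingHom) ≫ fromSpecFunField X :=
    congrArg (fun p => p.left) h
  have : Mono (fromSpecFunField X) :=
    inferInstanceAs (Mono (X.left.fromSpecStalk (genericPoint X.left)))
  have h2 := Spec.map_injective ((cancel_mono _).1 h1)
  exact AlgHom.ext fun a => congrArg (fun ψ => ψ.hom a) h2

theorem toPoint_comp_left {X : SchOver k} [IsCurve X] {F F' : Type u} [Field F] [Algebra k F]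
    [Field F'] [Algebra k F'] (φ : FunField X →ₐ[k] F) (ψ : F →ₐ[k] F') :
    (toPoint (ψ.comp φ)).left =
      Spec.map (CommRingCat.ofHom ψ.toRingHom) ≫ (toPoint φ).left := by
  change Spec.map (CommRingCat.ofHom (ψ.comp φ).toRingHom) ≫ fromSpecFunField X =
    Spec.map (CommRingCat.ofHom ψ.toRingHom) ≫
      Spec.map (CommRingCat.ofHom φ.toRingHom) ≫ fromSpecFunField X
  rw [← Category.assoc, ← Spec.map_comp]
  rfl

theorem toPoint_comp_pullbackAlgHom {Z X : SchOver k} [IsCurve Z] [IsCurve X] (f : Z ⟶ X)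
    [IsDominant f.left] {F : Type u} [Field F] [Algebra k F] (φ : FunField Z →ₐ[k] F) :
    toPoint (φ.comp (pullbackAlgHom f)) = toPoint φ ≫ f := by
  ext1
  change Spec.map (CommRingCat.ofHom (φ.comp (pullbackAlgHom f)).toRingHom) ≫ fromSpecFunField X =
    (Spec.map (CommRingCat.ofHom φ.toRingHom) ≫ fromSpecFunField Z) ≫ f.left
  rw [Category.assoc, ← specMap_pullbackHom, ← Category.assoc, ← Spec.map_comp]
  rfl

theorem toPoint_apply_closedPoint {X : SchOver k} [IsCurve X] {F : Type u} [Field F]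
    [Algebra k F] (φ : FunField X →ₐ[k] F) (y : Spec (CommRingCat.of F)) :
    (toPoint φ).left y = genericPoint X.left := by
  have h : (toPoint φ).left y ⤳ genericPoint X.left := by
    have : (toPoint φ).left y ∈ Set.range (X.left.fromSpecStalk (genericPoint X.left)) :=
      ⟨Spec.map (CommRingCat.ofHom φ.toRingHom) y, rfl⟩
    rwa [Scheme.range_fromSpecStalk] at this
  exact (h.antisymm (genericPoint_specializes _)).eq

/-- A point with values in a field that lies over the generic point along a quasi-finite morphism
is given by an embedding of function fields. -/
theorem exists_toPoint_left_eq {Z X : SchOver k} [IsCurve Z] [IsCurve X] (f : Z ⟶ X)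
    [IsDominant f.left] [LocallyQuasiFinite f.left] {F : Type u} [Field F] [Algebra k F]
    (v : FunField X →ₐ[k] F) (x : Spec (CommRingCat.of F) ⟶ Z.left)
    (hx : x ≫ f.left = (toPoint v).left) :
    ∃ e : FunField Z →ₐ[k] F, (toPoint e).left = x := by
  -- The image of `x` lies in the fibre over the generic point of `X`. That fibre is discrete and
  -- contains the generic point of `Z`, which specializes to every point.
  have hζ : x (IsLocalRing.closedPoint F) = genericPoint Z.left := by
    have h1 : f.left (x (IsLocalRing.closedPoint F)) = genericPoint X.left := by
      refine (Scheme.Hom.comp_apply x f.left _).symm.trans ?_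
      rw [hx]
      exact toPoint_apply_closedPoint v _
    have h2 := f.left.isDiscrete_preimage_singleton (genericPoint X.left)
    have := h2.to_subtype
    have h3 : (⟨_, map_genericPoint f⟩ : f.left ⁻¹' {genericPoint X.left}) ⤳ ⟨_, h1⟩ := by
      rw [subtype_specializes_iff]
      exact genericPoint_specializes _
    exact (congrArg Subtype.val h3.eq).symm
  have : ∀ ζ, ζ = genericPoint Z.left →
      (∃ ψ : Z.left.presheaf.stalk ζ ⟶ CommRingCat.of F,
        Spec.map ψ ≫ Z.left.fromSpecStalk ζ = x) →
      ∃ ψ : Z.left.presheaf.stalk (genericPoint Z.left) ⟶ CommRingCat.of F,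
        Spec.map ψ ≫ Z.left.fromSpecStalk (genericPoint Z.left) = x := by
    rintro _ rfl h
    exact h
  obtain ⟨ψ, hψ⟩ := this _ hζ ⟨_, Scheme.Spec_stalkClosedPointTo_fromSpecStalk x⟩
  let ψ' : CommRingCat.of (FunField Z) ⟶ CommRingCat.of F := ψ
  have hψ' : Spec.map ψ' ≫ fromSpecFunField Z = x := hψ
  have hk : CommRingCat.ofHom (algebraMap k (FunField Z)) ≫ ψ' =
      CommRingCat.ofHom (algebraMap k F) := by
    apply Spec.map_injective
    rw [Spec.map_comp, specMap_algebraMap_funField, ← Category.assoc, hψ', ← Over.w f,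
      ← Category.assoc, hx]
    exact Over.w (toPoint v)
  exact ⟨{ ψ'.hom with commutes' := fun r => congrArg (fun φ => φ.hom r) hk }, hψ'⟩

end Points

/-! ### Specialization of embeddings -/

namespace Correspondence

variable {k : Type u} [Field k] (C : Correspondence k) {Ω : Type u} [Field Ω] [Algebra k Ω]
  {PQ : FunField C.Z →ₐ[k] Ω} {kbar : Type u} [Field kbar] [Algebra k kbar]
  (w : Points (C.WInf PQ) kbar)

instance : IsLocalRing (C.localRing w) :=
  inferInstanceAs (IsLocalRing ((C.WInf PQ).left.presheaf.stalk (C.center w)))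

instance : IsLocalHom (C.evalAt w).hom :=
  Scheme.isLocalHom_stalkClosedPointTo' (R := kbar) w.left

theorem specMap_evalAt : Spec.map (C.evalAt w) ≫ C.fromSpecLocalRing w = w.left :=
  Scheme.Spec_stalkClosedPointTo_fromSpecStalk w.left

theorem exists_localRing_hom :
    ∃ ι : C.localRing w ⟶ CommRingCat.of (C.EInf PQ),
      Spec.map ι ≫ C.fromSpecLocalRing w = C.specEInfToWInf PQ ∧
      Function.Injective ι.hom ∧
      ∀ x : C.EInf PQ, ι.hom.IsIntegralElem x → x ∈ Set.range ι.hom :=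
  exists_stalk_normalization_hom (C.specEInfToZ PQ) (C.center w)

/-- The inclusion `𝒪_{W_∞, w} → E_∞`. -/
noncomputable def localRingHom : C.localRing w ⟶ CommRingCat.of (C.EInf PQ) :=
  (C.exists_localRing_hom w).choose

theorem specMap_localRingHom :
    Spec.map (C.localRingHom w) ≫ C.fromSpecLocalRing w = C.specEInfToWInf PQ :=
  (C.exists_localRing_hom w).choose_spec.1

theorem localRingHom_injective : Function.Injective (C.localRingHom w).hom :=
  (C.exists_localRing_hom w).choose_spec.2.1

theorem mem_range_localRingHom (x : C.EInf PQ) (hx : (C.localRingHom w).hom.IsIntegralElem x) :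
    x ∈ Set.range (C.localRingHom w).hom :=
  (C.exists_localRing_hom w).choose_spec.2.2 x hx

instance : IsDomain (C.localRing w) :=
  (C.localRingHom_injective w).isDomain (C.localRingHom w).hom

instance : IsDominant (Spec.map (C.localRingHom w)) :=
  ⟨(PrimeSpectrum.denseRange_comap_iff_ker_le_nilRadical (C.localRingHom w).hom).2
    (((RingHom.injective_iff_ker_eq_bot _).1 (C.localRingHom_injective w)).trans_le bot_le)⟩

/-- `Spec O → W_∞` is a monomorphism, so the map `η` in the definition is forced to be the one given
by `localRingHom`. -/
theorem specializesTo_iff {T : SchOver k} (x : Points T (C.EInf PQ)) (t : Points T kbar) :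
    C.SpecializesTo w x t ↔ ∃ h : Spec (C.localRing w) ⟶ T.left,
      h ≫ T.hom = C.fromSpecLocalRing w ≫ (C.WInf PQ).hom ∧
      Spec.map (C.localRingHom w) ≫ h = x.left ∧ Spec.map (C.evalAt w) ≫ h = t.left := by
  have : Mono (C.fromSpecLocalRing w) :=
    inferInstanceAs (Mono ((C.WInf PQ).left.fromSpecStalk (C.center w)))
  constructor
  · rintro ⟨η, h, h1, h2, h3, h4⟩
    obtain rfl : η = Spec.map (C.localRingHom w) := by
      rw [← cancel_mono (C.fromSpecLocalRing w), h1, specMap_localRingHom]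
    exact ⟨h, h2, h3, h4⟩
  · rintro ⟨h, h2, h3, h4⟩
    exact ⟨_, h, C.specMap_localRingHom w, h2, h3, h4⟩

/-- The embedding `φ` takes values in `E_∞` and, as an `E_∞`-point of `T`, specializes to `t`. -/
def EmbeddingSpecializesTo {T : SchOver k} [IsCurve T] (φ : FunField T →ₐ[k] Ω)
    (t : Points T kbar) : Prop :=
  ∃ φ₀ : FunField T →ₐ[k] C.EInf PQ,
    (C.EInf PQ).val.comp φ₀ = φ ∧ C.SpecializesTo w (toPoint φ₀) t

theorem comp_val_injective {K : Type u} [Field K] [Algebra k K]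
    {φ φ' : K →ₐ[k] C.EInf PQ} (h : (C.EInf PQ).val.comp φ = (C.EInf PQ).val.comp φ') :
    φ = φ' :=
  AlgHom.ext fun a => Subtype.ext (DFunLike.congr_fun h a)

variable {w}

/-- `Spec E_∞ → Spec O` is dominant, `O` is a domain and `T` is separated, so extensions over `Spec
O` are unique. -/
theorem EmbeddingSpecializesTo.unique {T : SchOver k} [hT : IsCurve T] {φ : FunField T →ₐ[k] Ω}
    {t t' : Points T kbar} (h : C.EmbeddingSpecializesTo w φ t)
    (h' : C.EmbeddingSpecializesTo w φ t') : t = t' := by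
  obtain ⟨φ₀, rfl, h⟩ := h
  obtain ⟨φ₁, h1, h'⟩ := h'
  obtain rfl := C.comp_val_injective h1
  rw [specializesTo_iff] at h h'
  obtain ⟨a, ha1, ha2, ha3⟩ := h
  obtain ⟨b, hb1, hb2, hb3⟩ := h'
  have := hT.separated
  obtain rfl : a = b := ext_of_isDominant_of_isSeparated T.hom (ha1.trans hb1.symm)
    (Spec.map (C.localRingHom w)) (ha2.trans hb2.symm)
  ext1
  exact ha3.symm.trans hb3

/-- The starting pair of the path argument: the extension of `PQ` over `Spec O` is the projection to
`Z`. -/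
theorem embeddingSpecializesTo_PQ :
    C.EmbeddingSpecializesTo w PQ (w ≫ C.WInfToZ PQ) := by
  refine ⟨C.toEInf PQ, rfl, (C.specializesTo_iff w _ _).2
    ⟨C.fromSpecLocalRing w ≫ (C.WInfToZ PQ).left, ?_, ?_, ?_⟩⟩
  · rw [Category.assoc, Over.w]
  · rw [← Category.assoc, specMap_localRingHom]
    exact (C.specEInfToZ PQ).toNormalization_fromNormalization
  · rw [← Category.assoc, specMap_evalAt]
    rfl

section

variable {T : SchOver k} [IsCurve T] (f : C.Z ⟶ T) [IsDominant f.left]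

theorem EmbeddingSpecializesTo.comp {e : FunField C.Z →ₐ[k] Ω} {t : Points C.Z kbar}
    (h : C.EmbeddingSpecializesTo w e t) :
    C.EmbeddingSpecializesTo w (e.comp (pullbackAlgHom f)) (t ≫ f) := by
  obtain ⟨e₀, rfl, h⟩ := h
  refine ⟨e₀.comp (pullbackAlgHom f), rfl, ?_⟩
  rw [specializesTo_iff] at h ⊢
  obtain ⟨h, h1, h2, h3⟩ := h
  refine ⟨h ≫ f.left, ?_, ?_, ?_⟩
  · rw [Category.assoc, Over.w, h1]
  · rw [toPoint_comp_pullbackAlgHom, ← Category.assoc, h2]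
    rfl
  · rw [← Category.assoc, h3]
    rfl

theorem EmbeddingSpecializesTo.exists_lift [IsIntegralHom f.left]
    {e : FunField C.Z →ₐ[k] Ω} (he : ∃ e₀, (C.EInf PQ).val.comp e₀ = e) {x : Points T kbar}
    (h : C.EmbeddingSpecializesTo w (e.comp (pullbackAlgHom f)) x) :
    ∃ t, C.EmbeddingSpecializesTo w e t ∧ t ≫ f = x := by
  obtain ⟨v₀, hv₀, h⟩ := h
  obtain ⟨e₀, rfl⟩ := he
  obtain rfl : v₀ = e₀.comp (pullbackAlgHom f) := C.comp_val_injective hv₀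
  rw [specializesTo_iff] at h
  obtain ⟨h, h1, h2, h3⟩ := h
  obtain ⟨h', h4, h5⟩ := exists_lift_of_isIntegralHom f.left h (C.localRingHom w)
    (C.localRingHom_injective w) (C.mem_range_localRingHom w) (toPoint e₀).left (by
      rw [h2, toPoint_comp_pullbackAlgHom]
      rfl)
  have h6 : h' ≫ C.Z.hom = C.fromSpecLocalRing w ≫ (C.WInf PQ).hom := by
    rw [← Over.w f, ← Category.assoc, h4, h1]
  have h7 : (Spec.map (C.evalAt w) ≫ h') ≫ C.Z.hom = w.left ≫ (C.WInf PQ).hom := by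
    rw [Category.assoc, h6, ← Category.assoc, specMap_evalAt]
    rfl
  let t : Points C.Z kbar := Over.homMk (Spec.map (C.evalAt w) ≫ h') (h7.trans (Over.w w))
  refine ⟨t, ⟨e₀, rfl, (C.specializesTo_iff w _ _).2 ⟨h', h6, h5, rfl⟩⟩, ?_⟩
  ext1
  change (Spec.map (C.evalAt w) ≫ h') ≫ f.left = x.left
  rw [Category.assoc, h4, h3]

/-- The two extensions agree after `f` because they do so generically. They also agree at the closed
point, and `f` is unramified. -/
theorem EmbeddingSpecializesTo.eq_of_comp_eq [Etale f.left] {e e' : FunField C.Z →ₐ[k] Ω}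
    {t : Points C.Z kbar} (h : C.EmbeddingSpecializesTo w e t)
    (h' : C.EmbeddingSpecializesTo w e' t)
    (hee : e.comp (pullbackAlgHom f) = e'.comp (pullbackAlgHom f)) : e = e' := by
  obtain ⟨e₀, rfl, h⟩ := h
  obtain ⟨e₁, rfl, h'⟩ := h'
  rw [specializesTo_iff] at h h'
  obtain ⟨a, ha1, ha2, ha3⟩ := h
  obtain ⟨b, hb1, hb2, hb3⟩ := h'
  have h0 : e₀.comp (pullbackAlgHom f) = e₁.comp (pullbackAlgHom f) := C.comp_val_injective hee
  have h1 : toPoint e₀ ≫ f = toPoint e₁ ≫ f := by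
    rw [← toPoint_comp_pullbackAlgHom, h0, toPoint_comp_pullbackAlgHom]
  have hT := IsCurve.separated (X := T)
  have hab : a ≫ f.left = b ≫ f.left := by
    refine ext_of_isDominant_of_isSeparated T.hom ?_ (Spec.map (C.localRingHom w)) ?_
    · rw [Category.assoc, Category.assoc, Over.w, ha1, hb1]
    · rw [← Category.assoc, ← Category.assoc, ha2, hb2]
      exact congrArg (fun p => p.left) h1
  obtain rfl := lift_eq_of_formallyUnramified f.left (C.evalAt w) hab (ha3.trans hb3.symm)
  congr 1
  apply toPoint_injective
  ext1
  exact ha2.symm.trans hb2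

theorem EmbeddingSpecializesTo.exists_comp_eq [IsAlgClosed Ω] [IsFinite f.left] [Etale f.left]
    {v : FunField T →ₐ[k] Ω} {t : Points C.Z kbar}
    (hv : ∀ e : FunField C.Z →ₐ[k] Ω, e.comp (pullbackAlgHom f) = v →
      ∃ e₀, (C.EInf PQ).val.comp e₀ = e)
    (h : C.EmbeddingSpecializesTo w v (t ≫ f)) :
    ∃ e, e.comp (pullbackAlgHom f) = v ∧ C.EmbeddingSpecializesTo w e t := by
  have h₀ := h
  obtain ⟨v₀, rfl, h⟩ := h
  rw [specializesTo_iff] at h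
  obtain ⟨h, h1, h2, h3⟩ := h
  let val := CommRingCat.ofHom (C.EInf PQ).val.toRingHom
  -- Going-down yields only an `Ω`-point. It is an embedding of `k(Z)` because `f` is quasi-finite,
  -- `hv` brings it into `E_∞`, and integral closedness then extends it over `Spec O`; `hx'` says
  -- that this extension specializes to `t`.
  obtain ⟨x, hx, hx'⟩ := exists_point_of_flat f.left h (C.localRingHom w ≫ val)
    ((C.EInf PQ).val.injective.comp (C.localRingHom_injective w)) (C.evalAt w) t.left h3.symm
  have hxv : x ≫ f.left = (toPoint ((C.EInf PQ).val.comp v₀)).left := by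
    rw [hx, Spec.map_comp, Category.assoc, h2, toPoint_comp_left]
  obtain ⟨e, he⟩ := exists_toPoint_left_eq f _ x hxv
  have hev : e.comp (pullbackAlgHom f) = (C.EInf PQ).val.comp v₀ := by
    apply toPoint_injective
    ext1
    rw [toPoint_comp_pullbackAlgHom, ← hxv, ← he]
    rfl
  obtain ⟨e₀, rfl⟩ := hv e hev
  obtain rfl : e₀.comp (pullbackAlgHom f) = v₀ := C.comp_val_injective hev
  obtain ⟨h', h4, h5⟩ := exists_lift_of_isIntegralHom f.left h (C.localRingHom w)
    (C.localRingHom_injective w) (C.mem_range_localRingHom w) (toPoint e₀).left (by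
      rw [h2, toPoint_comp_pullbackAlgHom]
      rfl)
  refine ⟨_, hev, e₀, rfl, (C.specializesTo_iff w _ _).2 ⟨h', ?_, h5, hx' h' h4 ?_⟩⟩
  · rw [← Over.w f, ← Category.assoc, h4, h1]
  · rw [Spec.map_comp, Category.assoc, h5, ← he, toPoint_comp_left]

end

variable (PQ) in
-- Conjugacy is propagated rather than mere containment in `E_∞`: crossing the next vertex requires
-- inverting the automorphism. The claim covers all edges at a vertex, as surjectivity on stars
-- needs.
theorem isConjugate_of_sameComponent [IsAlgClosed Ω] {v} (hv : (C.fullGenericGraph Ω).SameComponent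
      (Sum.inl ((C.fullGenericGraph Ω).blue PQ)) v) :
    Sum.elim (fun b => ∀ e : FunField C.Z →ₐ[k] Ω, e.comp (pullbackAlgHom C.f) = b →
        C.IsConjugate PQ e)
      (fun r => ∀ e : FunField C.Z →ₐ[k] Ω, e.comp (pullbackAlgHom C.g) = r →
        C.IsConjugate PQ e) v := by
  have hf {e e'} (he : C.IsConjugate PQ e)
      (hee : e'.comp (pullbackAlgHom C.f) = e.comp (pullbackAlgHom C.f)) : C.IsConjugate PQ e' :=
    IsConjugate.of_comp_eq C C.isIntegral_pullbackAlgHom_f (C.galoisClosure_f_le PQ) he hee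
  have hg {e e'} (he : C.IsConjugate PQ e)
      (hee : e'.comp (pullbackAlgHom C.g) = e.comp (pullbackAlgHom C.g)) : C.IsConjugate PQ e' :=
    IsConjugate.of_comp_eq C C.isIntegral_pullbackAlgHom_g (C.galoisClosure_g_le PQ) he hee
  refine hv.induction (Q := Sum.elim _ _) ?_ fun e _ => ⟨fun h e' he' => ?_, fun h e' he' => ?_⟩
  · exact fun e he => hf (e := PQ) ⟨.refl, fun _ => rfl⟩ he
  · exact hg (h e rfl) he'
  · exact hf (h e rfl) he'

end Correspondence

end CurveCorr

theorem lemma6p3 {k : Type u} [Field k] (C : CurveCorr.Correspondence k)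
    (hEtale : C.IsEtale) (hProj : C.IsProjective) (hHyp : C.Hyperbolic) (hCore : ¬ C.HasCore)
    {Ω : Type u} [Field Ω] [Algebra k Ω] [IsAlgClosed Ω] (hΩ : Algebra.trdeg k Ω = 1)
    (PQ : CurveCorr.FunField C.Z →ₐ[k] Ω)
    {kbar : Type u} [Field kbar] [Algebra k kbar] [IsAlgClosure k kbar]
    (z : CurveCorr.Points C.Z kbar) (w : CurveCorr.Points (C.WInf PQ) kbar)
    (hw : w ≫ C.WInfToZ PQ = z) :
    (∃! s : CurveCorr.BicoloredGraph.Map (C.genericGraph PQ) (C.physicalGraph z),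
      C.IsSpecializationMap w s) ∧
    ∀ s : CurveCorr.BicoloredGraph.Map (C.genericGraph PQ) (C.physicalGraph z),
      C.IsSpecializationMap w s → s.IsSurjective ∧ s.IsCovering := by
  subst hw
  obtain ⟨hf, hg⟩ := hEtale
  have land {e} (he : C.IsConjugate PQ e) := CurveCorr.Correspondence.IsConjugate.exists_comp_eq C he
  exact CurveCorr.BicoloredGraph.existsUnique_map_and_isCovering
    (G := C.fullGenericGraph Ω) (H := C.fullPhysicalGraph kbar) (e₀ := PQ)
    (RB := fun p x => C.EmbeddingSpecializesTo w p x)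
    (RR := fun q y => C.EmbeddingSpecializesTo w q y)
    (RE := fun e t => C.EmbeddingSpecializesTo w e t)
    C.embeddingSpecializesTo_PQ
    (fun h h' => h.unique C h') (fun h h' => h.unique C h') (fun h h' => h.unique C h')
    (fun h => h.comp C C.f) (fun h => h.comp C C.g)
    (fun he h => h.exists_lift C C.f (land (C.isConjugate_of_sameComponent PQ he _ rfl)))
    (fun he h => h.exists_lift C C.g (land (C.isConjugate_of_sameComponent PQ he _ rfl)))
    (fun h h' hee => h.eq_of_comp_eq C C.f h' hee)
    (fun h h' hee => h.eq_of_comp_eq C C.g h' hee)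
    (fun hv h => h.exists_comp_eq C C.f
      (fun _ he => land (C.isConjugate_of_sameComponent PQ hv _ he)))
    (fun hv h => h.exists_comp_eq C C.g
      (fun _ he => land (C.isConjugate_of_sameComponent PQ hv _ he)))
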